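/- Let $\mathcal E$ be a complex Hilbert space. For a Hilbert space $\mathcal X$ let $H^2_{\mathcal X}(\mathbb D)$ be the Hilbert space of $\mathcal X$-valued analytic functions on the open unit disc $\mathbb D$ with square-summable Taylor coefficients at $0$; for $A,B\in\mathcal B(\mathcal X)$ let $M_{A+Bz}$ be the operator $f(z)\mapsto (A+zB)f(z)$ on $H^2_{\mathcal X}(\mathbb D)$, and $M_z$ the operator $f(z)\mapsto zf(z)$. An inner function $(\mathcal E_*,\mathcal E,\Theta)$ is a bounded analytic function $\Theta:\mathbb D\to\mathcal B(\mathcal E_*,\mathcal E)$, $\mathcal E_*$ a Hilbert space, whose boundary values are isometric: for every $x\in\mathcal E_*$ and almost every $\theta$ the limit $\lim_{r\to1^-}\Theta(re^{i\theta})x$ exists and has norm $\|x\|$. It is a Beurling–Lax–Halmos representation of a closed subspace $\mathcal M\subseteq H^2_{\mathcal E}(\mathbb D)$ if $\mathcal M=\Theta H^2_{\mathcal E_*}(\mathbb D)$. A tetrablock unitary is a triple $(A,B,P)$ of commuting normal operators on a Hilbert space whose Taylor joint spectrum is contained in $$bE=\{(x_1,x_2,x_3)\in\mathbb C^3: x_1=\overline{x_2}\,x_3,\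 |x_3|=1,\ |x_2|\le 1\}.$$ A tetrablock isometry is (up to unitary equivalence) the restriction of a tetrablock unitary to a joint invariant subspace. **Theorem.** Let $F_1,F_2\in\mathcal B(\mathcal E)$, let $\mathcal M\neq\{0\}$ be a closed subspace of $H^2_{\mathcal E}(\mathbb D)$ and let $(\mathcal E_*,\mathcal E,\Theta)$ be a Beurling–Lax–Halmos representation of $\mathcal M$. Then $\mathcal M$ is invariant under each of $M_{F_1^*+F_2z}$, $M_{F_2^*+F_1z}$, $M_z$ if and only if there is a unique pair $G_1,G_2\in\mathcal B(\mathcal E_*)$ such that $$(F_1^*+F_2z)\Theta(z)=\Theta(z)(G_1+G_2^*z)\quad\text{and}\quad (F_2^*+F_1z)\Theta(z)=\Theta(z)(G_2+G_1^*z)\qquad\text{for all } z\in\mathbb D.$$ Moreover, for $G_1,G_2\in\mathcal B(\mathcal E_*)$ satisfying these two identities, if $(M_{F_1^*+F_2z},M_{F_2^*+F_1z},M_z)$ is a tetrablock isometry on $H^2_{\mathcal E}(\mathbb D)$, then $(M_{G_1+G_2^*z},M_{G_2+G_1^*z},M_z)$ is a tetrablock isometry on $H^2_{\mathcal E_*}(\mathbb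 D)$. -/

import Mathlib

open scoped ENNReal Topology InnerProduct

universe u

noncomputable section

/-! ### The vector-valued Hardy space of the disc -/

/-- `H²_E(𝔻)`: the Hilbert space of `E`-valued analytic functions on the unit disc with
square-summable Taylor coefficients at `0`. An element `f` is stored as its sequence `n ↦ f n` of
Taylor coefficients; the function itself is `Hardy.eval f`. -/
abbrev Hardy (E : Type u) [NormedAddCommGroup E] : Type u :=
  lp (fun _ : ℕ => E) 2

namespace Hardy

theorem summable_sq {E : Type u} [NormedAddCommGroup E] (f : Hardy E) :
    Summable (fun n : ℕ => ‖f n‖ ^ 2) := by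
  simpa using (lp.memℓp f).summable (by norm_num)

theorem norm_sq {E : Type u} [NormedAddCommGroup E] (f : Hardy E) :
    ‖f‖ ^ 2 = ∑' n : ℕ, ‖f n‖ ^ 2 := by
  simpa using lp.norm_rpow_eq_tsum (p := 2) (by norm_num) f

variable {E : Type u} [NormedAddCommGroup E] [InnerProductSpace ℂ E]

/-- The value `f(z) = ∑ zⁿ fₙ`; the series converges absolutely for `|z| < 1`
(`Hardy.summable_eval`). -/
def eval (f : Hardy E) (z : ℂ) : E :=
  ∑' n : ℕ, z ^ n • f n

theorem summable_norm_eval (f : Hardy E) {z : ℂ} (hz : z ∈ Metric.ball (0 : ℂ) 1) :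
    Summable (fun n : ℕ => ‖z ^ n • f n‖) := by
  have hz' : ‖z‖ < 1 := by simpa using hz
  refine Summable.of_nonneg_of_le (fun n => norm_nonneg _) (fun n => ?_)
    ((summable_geometric_of_lt_one (norm_nonneg z) hz').mul_right ‖f‖)
  rw [norm_smul, norm_pow]
  exact mul_le_mul_of_nonneg_left (lp.norm_apply_le_norm two_ne_zero f n) (by positivity)

theorem summable_eval [CompleteSpace E] (f : Hardy E) {z : ℂ}
    (hz : z ∈ Metric.ball (0 : ℂ) 1) : Summable (fun n : ℕ => z ^ n • f n) :=
  (summable_norm_eval f hz).of_norm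

/-- The coefficients of `z f(z)`. -/
def shiftSeq (f : ℕ → E) : ℕ → E
  | 0 => 0
  | n + 1 => f n

theorem memlp_shiftSeq {E : Type u} [NormedAddCommGroup E] (f : Hardy E) : Memℓp (shiftSeq f) 2 := by
  refine memℓp_gen ?_
  rw [← summable_nat_add_iff 1]
  simpa [shiftSeq] using summable_sq f

/-- The operator `M_z` of multiplication by the coordinate function on `H²_E(𝔻)`. -/
def Mz (E : Type u) [NormedAddCommGroup E] [InnerProductSpace ℂ E] : Hardy E →L[ℂ] Hardy E :=
  LinearMap.mkContinuous
    { toFun := fun f => ⟨shiftSeq f, memlp_shiftSeq f⟩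
      map_add' := fun f g => by
        ext n
        cases n with
        | zero => exact (add_zero (0 : E)).symm
        | succ n => rfl
      map_smul' := fun c f => by
        ext n
        cases n <;> simp [shiftSeq] }
    1 (fun f => by
      rw [one_mul]
      refine le_of_sq_le_sq ?_ (norm_nonneg _)
      rw [norm_sq, norm_sq, Summable.tsum_eq_zero_add (summable_sq _)]
      simp [shiftSeq])

@[simp]
theorem Mz_zero (f : Hardy E) : Mz E f 0 = 0 := rfl

@[simp]
theorem Mz_succ (f : Hardy E) (n : ℕ) : Mz E f (n + 1) = f n := rfl

theorem memlp_const (A : E →L[ℂ] E) (f : Hardy E) :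
    Memℓp (fun n : ℕ => A (f n)) 2 := by
  refine memℓp_gen ?_
  refine Summable.of_nonneg_of_le (fun n => by positivity) (fun n => ?_)
    ((summable_sq f).mul_left (‖A‖ ^ 2))
  have := pow_le_pow_left₀ (norm_nonneg _) (A.le_opNorm (f n)) 2
  simpa [mul_pow] using this

/-- Multiplication by the constant operator `A`, i.e. `I ⊗ A` on `H²(𝔻) ⊗ E`. -/
def Mconst (A : E →L[ℂ] E) : Hardy E →L[ℂ] Hardy E :=
  LinearMap.mkContinuous
    { toFun := fun f => ⟨fun n => A (f n), memlp_const A f⟩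
      map_add' := fun f g => by
        ext n
        exact A.map_add (f n) (g n)
      map_smul' := fun c f => by
        ext n
        simp }
    ‖A‖ (fun f => by
      refine le_of_sq_le_sq ?_ (by positivity)
      rw [mul_pow, norm_sq, norm_sq, ← tsum_mul_left]
      refine Summable.tsum_le_tsum (fun n => ?_) (summable_sq _) ((summable_sq f).mul_left _)
      have := pow_le_pow_left₀ (norm_nonneg _) (A.le_opNorm (f n)) 2
      simpa [mul_pow] using this)

@[simp]
theorem Mconst_apply (A : E →L[ℂ] E) (f : Hardy E) (n : ℕ) : Mconst A f n = A (f n) := rfl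

/-- The multiplication operator `M_{A + Bz}` on `H²_E(𝔻)`, for `A, B ∈ B(E)`. -/
def Mlin (A B : E →L[ℂ] E) : Hardy E →L[ℂ] Hardy E :=
  Mconst A + Mz E ∘L Mconst B

theorem eval_Mz [CompleteSpace E] (f : Hardy E) {z : ℂ} (hz : z ∈ Metric.ball (0 : ℂ) 1) :
    eval (Mz E f) z = z • eval f z := by
  unfold eval
  rw [(summable_eval _ hz).tsum_eq_zero_add, ← (summable_eval f hz).tsum_const_smul z]
  simp [pow_succ', mul_smul]

theorem eval_Mconst [CompleteSpace E] (A : E →L[ℂ] E) (f : Hardy E) {z : ℂ}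
    (hz : z ∈ Metric.ball (0 : ℂ) 1) : eval (Mconst A f) z = A (eval f z) := by
  unfold eval
  rw [A.map_tsum (summable_eval f hz)]
  simp

/-- `Mlin A B` is pointwise multiplication by the function `z ↦ A + z B`. -/
theorem eval_Mlin [CompleteSpace E] (A B : E →L[ℂ] E) (f : Hardy E) {z : ℂ}
    (hz : z ∈ Metric.ball (0 : ℂ) 1) :
    eval (Mlin A B f) z = (A + z • B) (eval f z) := by
  have h : eval (Mlin A B f) z = eval (Mconst A f) z + eval (Mz E (Mconst B f)) z := by
    unfold eval
    rw [← (summable_eval _ hz).tsum_add (summable_eval _ hz)]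
    simp [Mlin]
  rw [h, eval_Mz _ hz, eval_Mconst _ _ hz, eval_Mconst _ _ hz]
  simp

end Hardy

/-! ### Inner functions and Beurling–Lax–Halmos representations -/

section Inner

variable {E Estar : Type u}
  [NormedAddCommGroup E] [InnerProductSpace ℂ E]
  [NormedAddCommGroup Estar] [InnerProductSpace ℂ Estar]

/-- `(E_*, E, Θ)` is an inner function: a bounded analytic function on the disc with values in
`B(E_*, E)` whose (strong, radial) boundary values on the circle are isometries. The exceptional
null set may depend on the vector `x`; for separable `E_*` it can be chosen independently of `x`,
so that this says that `Θ(e^{iθ})` exists and is an isometry for almost every `θ`. Only the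
values of `Θ` on the open unit disc matter. -/
structure IsInner (Θ : ℂ → Estar →L[ℂ] E) : Prop where
  analytic : DifferentiableOn ℂ Θ (Metric.ball 0 1)
  bounded : ∃ C : ℝ, ∀ z ∈ Metric.ball (0 : ℂ) 1, ‖Θ z‖ ≤ C
  boundary : ∀ x : Estar, ∀ᵐ θ : ℝ, ∃ y : E,
    Filter.Tendsto (fun r : ℝ => Θ ((r : ℂ) * Complex.exp (θ * Complex.I)) x)
      (𝓝[<] (1 : ℝ)) (𝓝 y) ∧ ‖y‖ = ‖x‖

/-- `(E_*, E, Θ)` is a Beurling–Lax–Halmos representation of `M`: `Θ` is inner and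
`M = Θ H²_{E_*}(𝔻)`. -/
structure IsBLHRepresentation (M : Submodule ℂ (Hardy E)) (Θ : ℂ → Estar →L[ℂ] E) : Prop where
  inner : IsInner Θ
  mul_mem : ∀ f : Hardy Estar, ∃ g ∈ M,
    ∀ z ∈ Metric.ball (0 : ℂ) 1, Hardy.eval g z = Θ z (Hardy.eval f z)
  exists_eq_mul : ∀ g ∈ M, ∃ f : Hardy Estar,
    ∀ z ∈ Metric.ball (0 : ℂ) 1, Hardy.eval g z = Θ z (Hardy.eval f z)

end Inner

/-! ### Taylor joint spectrum, tetrablock unitaries and tetrablock isometries -/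

section Tetrablock

variable {H : Type u} [NormedAddCommGroup H] [InnerProductSpace ℂ H]

/-- Exactness of the Koszul complex `0 → H → H³ → H³ → H → 0` of the triple `(T₁, T₂, T₃)`. The
maps are `h ↦ (T₁h, T₂h, T₃h)`,
`(h₁, h₂, h₃) ↦ (T₂h₃ - T₃h₂, T₃h₁ - T₁h₃, T₁h₂ - T₂h₁)` and
`(h₁, h₂, h₃) ↦ T₁h₁ + T₂h₂ + T₃h₃`. -/
structure KoszulExact (T₁ T₂ T₃ : H →L[ℂ] H) : Prop where
  exact₀ : ∀ h : H, T₁ h = 0 → T₂ h = 0 → T₃ h = 0 → h = 0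
  exact₁ : ∀ h₁ h₂ h₃ : H, T₂ h₃ - T₃ h₂ = 0 → T₃ h₁ - T₁ h₃ = 0 → T₁ h₂ - T₂ h₁ = 0 →
    ∃ h : H, T₁ h = h₁ ∧ T₂ h = h₂ ∧ T₃ h = h₃
  exact₂ : ∀ k₁ k₂ k₃ : H, T₁ k₁ + T₂ k₂ + T₃ k₃ = 0 →
    ∃ h₁ h₂ h₃ : H, T₂ h₃ - T₃ h₂ = k₁ ∧ T₃ h₁ - T₁ h₃ = k₂ ∧ T₁ h₂ - T₂ h₁ = k₃
  exact₃ : ∀ k : H, ∃ h₁ h₂ h₃ : H, T₁ h₁ + T₂ h₂ + T₃ h₃ = k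

/-- The Taylor joint spectrum of a commuting triple: the points `(x₁, x₂, x₃)` for which the Koszul
complex of `(A - x₁, B - x₂, P - x₃)` is not exact. -/
def taylorSpectrum (A B P : H →L[ℂ] H) : Set (ℂ × ℂ × ℂ) :=
  {x | ¬ KoszulExact (A - x.1 • ContinuousLinearMap.id ℂ H)
    (B - x.2.1 • ContinuousLinearMap.id ℂ H) (P - x.2.2 • ContinuousLinearMap.id ℂ H)}

/-- The distinguished boundary `bE` of the tetrablock. -/
def tetrablockBoundary : Set (ℂ × ℂ × ℂ) :=
  {x | x.1 = starRingEnd ℂ x.2.1 * x.2.2 ∧ ‖x.2.2‖ = 1 ∧ ‖x.2.1‖ ≤ 1}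

/-- A tetrablock unitary: a commuting triple of normal operators whose Taylor joint spectrum is
contained in `bE`. -/
structure IsTetrablockUnitary [CompleteSpace H] (A B P : H →L[ℂ] H) : Prop where
  comm_AB : Commute A B
  comm_AP : Commute A P
  comm_BP : Commute B P
  normal_A : IsStarNormal A
  normal_B : IsStarNormal B
  normal_P : IsStarNormal P
  spectrum_subset : taylorSpectrum A B P ⊆ tetrablockBoundary

/-- A tetrablock isometry: the restriction of a tetrablock unitary `(A', B', P')` on a Hilbert
space `K` to a joint invariant subspace. The inclusion of the subspace is the isometry `V`, whose
range is invariant because of the intertwining relations. -/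
def IsTetrablockIsometry (A B P : H →L[ℂ] H) : Prop :=
  ∃ (K : Type u) (_ : NormedAddCommGroup K) (_ : InnerProductSpace ℂ K) (_ : CompleteSpace K)
    (A' B' P' : K →L[ℂ] K) (V : H →ₗᵢ[ℂ] K),
    IsTetrablockUnitary A' B' P' ∧
      ∀ h : H, A' (V h) = V (A h) ∧ B' (V h) = V (B h) ∧ P' (V h) = V (P h)

end Tetrablock

end

/-! ### Parseval's identity on circles -/

section Parseval

open MeasureTheory Filter

variable {E : Type u} [NormedAddCommGroup E] [InnerProductSpace ℂ E]

/-! Multiplication by `Θ` is an isometry `T` of `H²_{E_*}` onto `M` that commutes with the shift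
(`IsBLHRepresentation.exists_linearIsometry`). The two identities for `G₁, G₂` say exactly that `T`
intertwines the multiplication operators (`map_Mlin_iff_of_eval`), so they make `M = ran T`
invariant; shift invariance is automatic.

Conversely, invariance gives pullbacks `S₁, S₂` along `T` commuting with the shift. The relations
`M_{F₁*+F₂z} = M_{F₂*+F₁z}* M_z` and its mirror image survive the pullback: `S₁ = S₂* M_z` and `S₂ =
S₁* M_z`. With shift commutation they force both symbols to have degree at most one with matching
coefficients (`Hardy.eq_Mlin_of_inner`). Uniqueness follows from injectivity of `T` and of the
passage from symbol to operator. For the last claim, compose the embedding into a tetrablock unitary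
with `T`.

The analytic input is that `T` preserves norms. The exceptional null set in `IsInner` depends on the
vector, so this is proved for polynomials by Parseval and a limit `r → 1`, and extended by density.
-/

theorem norm_exp_mul_I_pow (θ : ℝ) (n : ℕ) : ‖Complex.exp (θ * Complex.I) ^ n‖ = 1 := by
  rw [norm_pow, Complex.norm_exp_ofReal_mul_I, one_pow]

theorem integral_conj_exp_pow_mul_exp_pow (m n : ℕ) :
    ∫ θ in (0 : ℝ)..2 * Real.pi, starRingEnd ℂ (Complex.exp (θ * Complex.I) ^ m) *
      Complex.exp (θ * Complex.I) ^ n = if m = n then 2 * (Real.pi : ℂ) else 0 := by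
  have key : ∀ θ : ℝ, starRingEnd ℂ (Complex.exp (θ * Complex.I) ^ m) *
      Complex.exp (θ * Complex.I) ^ n
        = Complex.exp ((((n : ℤ) - (m : ℤ) : ℤ) : ℂ) * Complex.I * (θ : ℂ)) := by
    intro θ
    rw [map_pow, ← Complex.exp_conj, ← Complex.exp_nat_mul, ← Complex.exp_nat_mul,
      ← Complex.exp_add]
    congr 1
    simp only [map_mul, Complex.conj_ofReal, Complex.conj_I]
    push_cast
    ring
  simp_rw [key]
  split_ifs with h
  · subst h
    simp
  · have hc : (((n : ℤ) - (m : ℤ) : ℤ) : ℂ) * Complex.I ≠ 0 := by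
      refine mul_ne_zero ?_ Complex.I_ne_zero
      exact Int.cast_ne_zero.mpr (by omega)
    rw [integral_exp_mul_complex hc]
    have : (((n : ℤ) - (m : ℤ) : ℤ) : ℂ) * Complex.I * ((2 * Real.pi : ℝ) : ℂ)
        = (((n : ℤ) - (m : ℤ) : ℤ) : ℂ) * (2 * Real.pi * Complex.I) := by
      push_cast; ring
    rw [this, Complex.exp_int_mul_two_pi_mul_I]
    simp

/-- The square of the norm of a finite linear combination, expanded through the Gram matrix. -/
theorem ofReal_norm_sum_smul_sq (s : Finset ℕ) (c : ℕ → ℂ) (a : ℕ → E) :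
    ((‖∑ k ∈ s, c k • a k‖ ^ 2 : ℝ) : ℂ)
      = ∑ k ∈ s, ∑ l ∈ s, starRingEnd ℂ (c k) * c l * inner ℂ (a k) (a l) := by
  have h := inner_self_eq_norm_sq_to_K (𝕜 := ℂ) (∑ k ∈ s, c k • a k)
  rw [Complex.ofReal_pow]
  refine h.symm.trans ?_
  rw [sum_inner]
  refine Finset.sum_congr rfl fun k _ => ?_
  rw [inner_sum]
  refine Finset.sum_congr rfl fun l _ => ?_
  rw [inner_smul_left, inner_smul_right, mul_assoc]

/-- Parseval's identity for trigonometric polynomials with coefficients in a Hilbert space. -/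
theorem integral_norm_trigPoly_sq (s : Finset ℕ) (a : ℕ → E) :
    ∫ θ in (0 : ℝ)..2 * Real.pi, ‖∑ k ∈ s, Complex.exp (θ * Complex.I) ^ k • a k‖ ^ 2
      = 2 * Real.pi * ∑ k ∈ s, ‖a k‖ ^ 2 := by
  apply Complex.ofReal_injective
  rw [← intervalIntegral.integral_ofReal]
  simp_rw [ofReal_norm_sum_smul_sq]
  have hcont : ∀ k l : ℕ, Continuous fun θ : ℝ =>
      starRingEnd ℂ (Complex.exp (θ * Complex.I) ^ k) * Complex.exp (θ * Complex.I) ^ l *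
        inner ℂ (a k) (a l) := by
    intro k l
    refine Continuous.mul (Continuous.mul (Complex.continuous_conj.comp ?_) ?_)
      continuous_const <;> fun_prop
  rw [intervalIntegral.integral_finsetSum fun k _ =>
    (continuous_finsetSum s fun l _ => hcont k l).intervalIntegrable _ _]
  push_cast
  rw [Finset.mul_sum]
  refine Finset.sum_congr rfl fun k hk => ?_
  rw [intervalIntegral.integral_finsetSum fun l _ => (hcont k l).intervalIntegrable _ _]
  simp_rw [intervalIntegral.integral_mul_const, integral_conj_exp_pow_mul_exp_pow, ite_mul,
    zero_mul]
  rw [Finset.sum_ite_eq s k, if_pos hk, inner_self_eq_norm_sq_to_K]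
  rfl

variable [CompleteSpace E]

theorem summable_exp_pow_smul {a : ℕ → E} (ha : Summable fun n => ‖a n‖) (θ : ℝ) :
    Summable fun n => Complex.exp (θ * Complex.I) ^ n • a n := by
  refine Summable.of_norm ?_
  simpa only [norm_smul, norm_exp_mul_I_pow, one_mul] using ha

theorem continuous_tsum_exp_pow_smul {a : ℕ → E} (ha : Summable fun n => ‖a n‖) :
    Continuous fun θ : ℝ => ∑' n, Complex.exp (θ * Complex.I) ^ n • a n := by
  refine continuous_tsum (fun n => by fun_prop) ha fun n θ => ?_
  rw [norm_smul, norm_exp_mul_I_pow, one_mul]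

/-- Parseval's identity for absolutely convergent one-sided Fourier series. -/
theorem integral_norm_tsum_exp_pow_smul_sq {a : ℕ → E} (ha : Summable fun n => ‖a n‖) :
    ∫ θ in (0 : ℝ)..2 * Real.pi, ‖∑' n, Complex.exp (θ * Complex.I) ^ n • a n‖ ^ 2
      = 2 * Real.pi * ∑' n, ‖a n‖ ^ 2 := by
  -- An absolutely summable sequence is square summable because `‖aₙ‖² ≤ (∑ ‖aₖ‖) ‖aₙ‖`.
  have hsq : Summable fun n => ‖a n‖ ^ 2 := by
    refine Summable.of_nonneg_of_le (fun n => by positivity) (fun n => ?_)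
      (ha.mul_left (∑' n, ‖a n‖))
    rw [sq]
    exact mul_le_mul_of_nonneg_right (ha.le_tsum n fun _ _ => norm_nonneg _) (norm_nonneg _)
  have h₁ : Tendsto (fun N : ℕ => ∫ θ in (0 : ℝ)..2 * Real.pi,
      ‖∑ k ∈ Finset.range N, Complex.exp (θ * Complex.I) ^ k • a k‖ ^ 2) atTop
      (𝓝 (∫ θ in (0 : ℝ)..2 * Real.pi,
        ‖∑' n, Complex.exp (θ * Complex.I) ^ n • a n‖ ^ 2)) := by
    refine intervalIntegral.tendsto_integral_filter_of_dominated_convergence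
      (fun _ => (∑' n, ‖a n‖) ^ 2) ?_ ?_ intervalIntegrable_const ?_
    · refine Eventually.of_forall fun N => Continuous.aestronglyMeasurable ?_
      fun_prop
    · refine Eventually.of_forall fun N => Eventually.of_forall fun θ _ => ?_
      rw [Real.norm_of_nonneg (by positivity)]
      refine pow_le_pow_left₀ (norm_nonneg _) ((norm_sum_le _ _).trans ?_) 2
      simp_rw [norm_smul, norm_exp_mul_I_pow, one_mul]
      exact ha.sum_le_tsum _ fun _ _ => norm_nonneg _
    · refine Eventually.of_forall fun θ _ => ?_
      exact ((summable_exp_pow_smul ha θ).hasSum.tendsto_sum_nat.norm).pow 2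
  have h₂ := (hsq.hasSum.tendsto_sum_nat).const_mul (2 * Real.pi)
  simp_rw [integral_norm_trigPoly_sq] at h₁
  exact tendsto_nhds_unique h₁ h₂

end Parseval

/-! ### Values of functions in the Hardy space -/

namespace Hardy

open MeasureTheory Filter

variable {E : Type u} [NormedAddCommGroup E] [InnerProductSpace ℂ E]

theorem norm_ofReal_mul_exp_lt_one {r : ℝ} (h₀ : 0 ≤ r) (h₁ : r < 1) (θ : ℝ) :
    (r : ℂ) * Complex.exp (θ * Complex.I) ∈ Metric.ball (0 : ℂ) 1 := by
  simpa [Complex.norm_exp_ofReal_mul_I, abs_of_nonneg h₀] using h₁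

theorem summable_norm_ofReal_pow_smul (f : Hardy E) {r : ℝ} (h₀ : 0 ≤ r) (h₁ : r < 1) :
    Summable fun n : ℕ => ‖(r : ℂ) ^ n • f n‖ :=
  summable_norm_eval f (by simpa [abs_of_nonneg h₀] using h₁)

theorem eval_ofReal_mul_exp (f : Hardy E) (r θ : ℝ) :
    eval f ((r : ℂ) * Complex.exp (θ * Complex.I))
      = ∑' n : ℕ, Complex.exp (θ * Complex.I) ^ n • (r : ℂ) ^ n • f n := by
  unfold eval
  refine tsum_congr fun n => ?_
  rw [mul_pow, mul_comm, mul_smul]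

theorem continuous_eval_circle [CompleteSpace E] (f : Hardy E) {r : ℝ} (h₀ : 0 ≤ r) (h₁ : r < 1) :
    Continuous fun θ : ℝ => eval f ((r : ℂ) * Complex.exp (θ * Complex.I)) := by
  simp_rw [eval_ofReal_mul_exp]
  exact continuous_tsum_exp_pow_smul (summable_norm_ofReal_pow_smul f h₀ h₁)

theorem eval_add [CompleteSpace E] (f g : Hardy E) {z : ℂ} (hz : z ∈ Metric.ball (0 : ℂ) 1) :
    eval (f + g) z = eval f z + eval g z := by
  unfold eval
  rw [← (summable_eval f hz).tsum_add (summable_eval g hz)]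
  simp

theorem eval_smul [CompleteSpace E] (c : ℂ) (f : Hardy E) {z : ℂ}
    (hz : z ∈ Metric.ball (0 : ℂ) 1) : eval (c • f) z = c • eval f z := by
  unfold eval
  rw [← (summable_eval f hz).tsum_const_smul c]
  simp [smul_comm c]

theorem eval_sub [CompleteSpace E] (f g : Hardy E) {z : ℂ} (hz : z ∈ Metric.ball (0 : ℂ) 1) :
    eval (f - g) z = eval f z - eval g z := by
  unfold eval
  rw [← (summable_eval f hz).tsum_sub (summable_eval g hz)]
  simp [smul_sub]

theorem norm_eval_le (f : Hardy E) {z : ℂ} (hz : z ∈ Metric.ball (0 : ℂ) 1) :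
    ‖eval f z‖ ≤ (∑' n : ℕ, ‖z‖ ^ n) * ‖f‖ := by
  have hz' : ‖z‖ < 1 := by simpa using hz
  refine (norm_tsum_le_tsum_norm (summable_norm_eval f hz)).trans ?_
  rw [← tsum_mul_right]
  refine (summable_norm_eval f hz).tsum_le_tsum (fun n => ?_)
    ((summable_geometric_of_lt_one (norm_nonneg z) hz').mul_right ‖f‖)
  rw [norm_smul, norm_pow]
  exact mul_le_mul_of_nonneg_left (lp.norm_apply_le_norm two_ne_zero f n) (by positivity)

/-- Evaluation at a point of the disc as a bounded operator. -/
noncomputable def evalCLM [CompleteSpace E] {z : ℂ} (hz : z ∈ Metric.ball (0 : ℂ) 1) : Hardy E →L[ℂ] E :=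
  LinearMap.mkContinuous
    { toFun := fun f => eval f z
      map_add' := fun f g => eval_add f g hz
      map_smul' := fun c f => eval_smul c f hz }
    (∑' n : ℕ, ‖z‖ ^ n) (fun f => norm_eval_le f hz)

@[simp]
theorem evalCLM_apply [CompleteSpace E] {z : ℂ} (hz : z ∈ Metric.ball (0 : ℂ) 1)
    (f : Hardy E) : evalCLM hz f = eval f z := rfl

theorem integral_norm_eval_sq [CompleteSpace E] (f : Hardy E) {r : ℝ} (h₀ : 0 ≤ r) (h₁ : r < 1) :
    ∫ θ in (0 : ℝ)..2 * Real.pi, ‖eval f ((r : ℂ) * Complex.exp (θ * Complex.I))‖ ^ 2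
      = 2 * Real.pi * ∑' n : ℕ, ‖(r : ℂ) ^ n • f n‖ ^ 2 := by
  simp_rw [eval_ofReal_mul_exp]
  exact integral_norm_tsum_exp_pow_smul_sq (summable_norm_ofReal_pow_smul f h₀ h₁)

/-- By Parseval on the circle of radius `1/2`, a difference vanishing there has all its weighted
coefficients zero. -/
theorem ext_eval [CompleteSpace E] {f g : Hardy E}
    (h : ∀ z ∈ Metric.ball (0 : ℂ) 1, eval f z = eval g z) : f = g := by
  have h₀ : (0 : ℝ) ≤ 1 / 2 := by norm_num
  have h₁ : (1 / 2 : ℝ) < 1 := by norm_num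
  have hint := integral_norm_eval_sq (f - g) h₀ h₁
  have hzero : ∀ θ : ℝ,
      eval (f - g) (((1 / 2 : ℝ) : ℂ) * Complex.exp (θ * Complex.I)) = 0 := fun θ => by
    have hz := norm_ofReal_mul_exp_lt_one h₀ h₁ θ
    rw [eval_sub _ _ hz, h _ hz, sub_self]
  simp_rw [hzero] at hint
  have hsum : Summable fun n : ℕ => ‖(((1 / 2 : ℝ) : ℂ)) ^ n • (f - g) n‖ ^ 2 := by
    refine Summable.of_nonneg_of_le (fun n => by positivity) (fun n => ?_) (summable_sq (f - g))
    refine pow_le_pow_left₀ (norm_nonneg _) ?_ 2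
    rw [norm_smul, norm_pow]
    refine mul_le_of_le_one_left (norm_nonneg _) (pow_le_one₀ (norm_nonneg _) ?_)
    norm_num
  have htsum : ∑' n : ℕ, ‖(((1 / 2 : ℝ) : ℂ)) ^ n • (f - g) n‖ ^ 2 = 0 := by
    have hpi : 2 * Real.pi ≠ 0 := by positivity
    simpa [hpi, Real.pi_ne_zero] using hint.symm
  refine sub_eq_zero.mp ?_
  ext n
  have := (hsum.hasSum_iff.mpr htsum)
  rw [hasSum_zero_iff_of_nonneg fun n => by positivity] at this
  have hn := congrFun this n
  simpa using hn

/-- With `integral_norm_eval_sq` this recovers the Hardy norm from circle means as `r → 1`; the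
terms are dominated by `‖fₙ‖²`. -/
theorem tendsto_tsum_norm_ofReal_pow_smul_sq (f : Hardy E) :
    Tendsto (fun r : ℝ => ∑' n : ℕ, ‖(r : ℂ) ^ n • f n‖ ^ 2) (𝓝[<] 1) (𝓝 (‖f‖ ^ 2)) := by
  rw [norm_sq]
  refine tendsto_tsum_of_dominated_convergence (summable_sq f) (fun n => ?_) ?_
  · have : Continuous fun r : ℝ => ‖(r : ℂ) ^ n • f n‖ ^ 2 := by fun_prop
    simpa using (this.tendsto 1).mono_left nhdsWithin_le_nhds
  · filter_upwards [Ioo_mem_nhdsLT (zero_lt_one' ℝ)] with r hr n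
    rw [Real.norm_of_nonneg (by positivity)]
    refine pow_le_pow_left₀ (norm_nonneg _) ?_ 2
    rw [norm_smul, norm_pow]
    refine mul_le_of_le_one_left (norm_nonneg _) (pow_le_one₀ (norm_nonneg _) ?_)
    simpa [abs_of_pos hr.1] using hr.2.le

/-! ### Polynomials and their density. -/

theorem eval_single (k : ℕ) (x : E) (z : ℂ) :
    eval (lp.single 2 k x : Hardy E) z = z ^ k • x := by
  unfold eval
  rw [tsum_eq_single k fun n hn => by simp [hn]]
  simp

/-- The polynomial `∑ zᵏ xₖ`, `k < N`. -/
noncomputable def poly {E : Type u} [NormedAddCommGroup E] (x : ℕ → E) (N : ℕ) : Hardy E :=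
  ∑ k ∈ Finset.range N, lp.single 2 k (x k)

theorem poly_apply {E : Type u} [NormedAddCommGroup E] (x : ℕ → E) (N n : ℕ) : poly x N n = if n < N then x n else 0 := by
  unfold poly
  rw [lp.coeFn_sum, Finset.sum_apply]
  simp only [lp.coeFn_single, Pi.single_apply]
  simp

theorem eval_poly [CompleteSpace E] (x : ℕ → E) (N : ℕ) {z : ℂ}
    (hz : z ∈ Metric.ball (0 : ℂ) 1) :
    eval (poly x N) z = ∑ k ∈ Finset.range N, z ^ k • x k := by
  rw [← evalCLM_apply hz, poly, map_sum]
  simp_rw [evalCLM_apply, eval_single]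

theorem norm_poly_sq {E : Type u} [NormedAddCommGroup E] (x : ℕ → E) (N : ℕ) :
    ‖poly x N‖ ^ 2 = ∑ k ∈ Finset.range N, ‖x k‖ ^ 2 := by
  rw [norm_sq, tsum_eq_sum (s := Finset.range N) fun n hn => by
    simp [poly_apply, Finset.mem_range.not.mp hn]]
  exact Finset.sum_congr rfl fun n hn => by simp [poly_apply, Finset.mem_range.mp hn]

theorem tendsto_poly {E : Type u} [NormedAddCommGroup E] (f : Hardy E) : Tendsto (fun N => poly f N) atTop (𝓝 f) :=
  (lp.hasSum_single (by norm_num) f).tendsto_sum_nat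

end Hardy

/-! ### Multiplication by an inner function -/

section InnerMultiplier

open MeasureTheory Filter Hardy

variable {E Estar : Type u}
  [NormedAddCommGroup E] [InnerProductSpace ℂ E]
  [NormedAddCommGroup Estar] [InnerProductSpace ℂ Estar]
  {Θ : ℂ → Estar →L[ℂ] E}

theorem IsInner.tendsto_norm_sq (hΘ : IsInner Θ) (x : Estar) : ∀ᵐ θ : ℝ,
    Tendsto (fun r : ℝ => ((‖Θ ((r : ℂ) * Complex.exp (θ * Complex.I)) x‖ : ℂ)) ^ 2) (𝓝[<] 1)
      (𝓝 ((‖x‖ : ℂ) ^ 2)) := by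
  filter_upwards [hΘ.boundary x] with θ ⟨y, hy, hyx⟩
  rw [← hyx]
  exact ((Complex.continuous_ofReal.tendsto _).comp hy.norm).pow 2

/-- The boundary values of an inner function preserve inner products. -/
theorem IsInner.tendsto_inner (hΘ : IsInner Θ) (x y : Estar) : ∀ᵐ θ : ℝ,
    Tendsto (fun r : ℝ => (inner ℂ (Θ ((r : ℂ) * Complex.exp (θ * Complex.I)) x)
      (Θ ((r : ℂ) * Complex.exp (θ * Complex.I)) y) : ℂ)) (𝓝[<] 1) (𝓝 (inner ℂ x y)) := by
  -- Polarization reduces the inner product to four norms; the null set depends on the pair `x, y`.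
  filter_upwards [hΘ.tendsto_norm_sq (x + y), hΘ.tendsto_norm_sq (x - y),
    hΘ.tendsto_norm_sq (x - (RCLike.I : ℂ) • y), hΘ.tendsto_norm_sq (x + (RCLike.I : ℂ) • y)]
    with θ h₁ h₂ h₃ h₄
  simp_rw [inner_eq_sum_norm_sq_div_four, ← map_smul, ← map_add, ← map_sub]
  exact (((h₁.sub h₂).add ((h₃.sub h₄).mul_const _)).div_const _)

/-- The vector to which `Θ` is applied varies with `r` and `θ`, but only through scalars. Expanding
in the Gram matrix leaves countably many pairs `x k, x l`, hence one common null set. -/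
theorem IsInner.tendsto_norm_mul_trigPoly_sq (hΘ : IsInner Θ) (x : ℕ → Estar) (N : ℕ) :
    ∀ᵐ θ : ℝ, Tendsto (fun r : ℝ => ‖Θ ((r : ℂ) * Complex.exp (θ * Complex.I))
        (∑ k ∈ Finset.range N, ((r : ℂ) * Complex.exp (θ * Complex.I)) ^ k • x k)‖ ^ 2) (𝓝[<] 1)
      (𝓝 (‖∑ k ∈ Finset.range N, Complex.exp (θ * Complex.I) ^ k • x k‖ ^ 2)) := by
  have hall : ∀ᵐ θ : ℝ, ∀ k l : ℕ, Tendsto (fun r : ℝ =>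
      (inner ℂ (Θ ((r : ℂ) * Complex.exp (θ * Complex.I)) (x k))
        (Θ ((r : ℂ) * Complex.exp (θ * Complex.I)) (x l)) : ℂ)) (𝓝[<] 1)
        (𝓝 (inner ℂ (x k) (x l))) :=
    ae_all_iff.mpr fun k => ae_all_iff.mpr fun l => hΘ.tendsto_inner (x k) (x l)
  filter_upwards [hall] with θ hθ
  have hc : ∀ k : ℕ, Tendsto (fun r : ℝ => ((r : ℂ) * Complex.exp (θ * Complex.I)) ^ k) (𝓝[<] 1)
      (𝓝 (Complex.exp (θ * Complex.I) ^ k)) := fun k => by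
    have : Continuous fun r : ℝ => ((r : ℂ) * Complex.exp (θ * Complex.I)) ^ k := by fun_prop
    simpa using (this.tendsto 1).mono_left nhdsWithin_le_nhds
  have hC : Tendsto (fun r : ℝ => ((‖Θ ((r : ℂ) * Complex.exp (θ * Complex.I))
        (∑ k ∈ Finset.range N, ((r : ℂ) * Complex.exp (θ * Complex.I)) ^ k • x k)‖ ^ 2 : ℝ) : ℂ))
      (𝓝[<] 1)
      (𝓝 ((‖∑ k ∈ Finset.range N, Complex.exp (θ * Complex.I) ^ k • x k‖ ^ 2 : ℝ) : ℂ)) := by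
    simp_rw [map_sum, map_smul, ofReal_norm_sum_smul_sq]
    refine tendsto_finsetSum _ fun k _ => tendsto_finsetSum _ fun l _ => ?_
    exact (((Complex.continuous_conj.tendsto _).comp (hc k)).mul (hc l)).mul (hθ k l)
  have hre := (Complex.continuous_re.tendsto _).comp hC
  simpa only [Function.comp_def, Complex.ofReal_re] using hre

variable [CompleteSpace E] [CompleteSpace Estar]

/-- The circle means of `‖g‖²` have two limits as `r → 1`: one from the boundary values of `Θ` by
dominated convergence, the other from the coefficients of `g`. -/
theorem IsInner.norm_mul_poly (hΘ : IsInner Θ) (x : ℕ → Estar) (N : ℕ) {g : Hardy E}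
    (hg : ∀ z ∈ Metric.ball (0 : ℂ) 1, eval g z = Θ z (eval (poly x N) z)) :
    ‖g‖ = ‖poly x N‖ := by
  obtain ⟨C, hC⟩ := hΘ.bounded
  have hIoo : Set.Ioo (0 : ℝ) 1 ∈ 𝓝[<] (1 : ℝ) := Ioo_mem_nhdsLT (zero_lt_one' ℝ)
  have hlim : Tendsto (fun r : ℝ => ∫ θ in (0 : ℝ)..2 * Real.pi,
      ‖eval g ((r : ℂ) * Complex.exp (θ * Complex.I))‖ ^ 2) (𝓝[<] 1)
      (𝓝 (∫ θ in (0 : ℝ)..2 * Real.pi,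
        ‖∑ k ∈ Finset.range N, Complex.exp (θ * Complex.I) ^ k • x k‖ ^ 2)) := by
    -- On the disc `C` bounds `Θ` and `∑ ‖x k‖` bounds the polynomial.
    refine intervalIntegral.tendsto_integral_filter_of_dominated_convergence
      (fun _ => (C * ∑ k ∈ Finset.range N, ‖x k‖) ^ 2) ?_ ?_ intervalIntegrable_const ?_
    · filter_upwards [hIoo] with r hr
      exact ((continuous_eval_circle g hr.1.le hr.2).norm.pow 2).aestronglyMeasurable
    · filter_upwards [hIoo] with r hr
      refine Eventually.of_forall fun θ _ => ?_
      have hz := norm_ofReal_mul_exp_lt_one hr.1.le hr.2 θ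
      rw [Real.norm_of_nonneg (by positivity), hg _ hz, eval_poly _ _ hz]
      refine pow_le_pow_left₀ (norm_nonneg _) (((Θ _).le_opNorm _).trans ?_) 2
      refine mul_le_mul (hC _ hz) ((norm_sum_le _ _).trans (Finset.sum_le_sum fun k _ => ?_))
        (norm_nonneg _) ((norm_nonneg _).trans (hC _ hz))
      rw [norm_smul, norm_pow]
      exact mul_le_of_le_one_left (norm_nonneg _)
        (pow_le_one₀ (norm_nonneg _) (mem_ball_zero_iff.mp hz).le)
    · filter_upwards [hΘ.tendsto_norm_mul_trigPoly_sq x N] with θ hθ _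
      refine hθ.congr' ?_
      filter_upwards [hIoo] with r hr
      have hz := norm_ofReal_mul_exp_lt_one hr.1.le hr.2 θ
      rw [hg _ hz, eval_poly _ _ hz]
  rw [integral_norm_trigPoly_sq, ← norm_poly_sq] at hlim
  have hlim' := (tendsto_tsum_norm_ofReal_pow_smul_sq g).const_mul (2 * Real.pi)
  have heq := tendsto_nhds_unique (hlim.congr' (by
    filter_upwards [hIoo] with r hr
    exact integral_norm_eval_sq g hr.1.le hr.2)) hlim'
  have hpi : 2 * Real.pi ≠ 0 := by positivity
  exact ((sq_eq_sq₀ (norm_nonneg _) (norm_nonneg _)).mp (mul_left_cancel₀ hpi heq)).symm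

/-- An inner function maps `H²_{E_*}` isometrically onto the subspace it represents. -/
theorem IsBLHRepresentation.exists_linearIsometry {M : Submodule ℂ (Hardy E)}
    (hΘ : IsBLHRepresentation M Θ) :
    ∃ T : Hardy Estar →ₗᵢ[ℂ] Hardy E,
      (∀ f, ∀ z ∈ Metric.ball (0 : ℂ) 1, eval (T f) z = Θ z (eval f z)) ∧
      ∀ g, g ∈ M ↔ ∃ f, T f = g := by
  choose S hSM hS using hΘ.mul_mem
  let L : Hardy Estar →ₗ[ℂ] Hardy E :=
    { toFun := S
      map_add' := fun f g => ext_eval fun z hz => by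
        rw [hS _ z hz, eval_add _ _ hz, eval_add _ _ hz, hS _ z hz, hS _ z hz, map_add]
      map_smul' := fun c f => ext_eval fun z hz => by
        rw [hS _ z hz, RingHom.id_apply, eval_smul _ _ hz, eval_smul _ _ hz, hS _ z hz,
          map_smul] }
  -- Closed graph theorem: point evaluations are continuous and separate elements.
  have hLcont : Continuous L := by
    refine L.continuous_of_seq_closed_graph fun u f g hu hLu => ext_eval fun z hz => ?_
    have h₁ := ((evalCLM (E := E) hz).continuous.tendsto g).comp hLu
    have h₂ := ((Θ z).continuous.tendsto _).comp
      (((evalCLM (E := Estar) hz).continuous.tendsto f).comp hu)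
    refine (tendsto_nhds_unique h₁ (h₂.congr fun n => ?_)).trans (hS f z hz).symm
    exact (hS (u n) z hz).symm
  have hLnorm : ∀ f, ‖L f‖ = ‖f‖ := fun f => by
    refine tendsto_nhds_unique (((hLcont.tendsto f).comp (tendsto_poly f)).norm)
      ((tendsto_poly f).norm.congr fun N => ?_)
    exact (hΘ.inner.norm_mul_poly f N (hS _)).symm
  refine ⟨⟨L, hLnorm⟩, hS, fun g => ⟨fun hg => ?_, ?_⟩⟩
  · obtain ⟨f, hf⟩ := hΘ.exists_eq_mul g hg
    exact ⟨f, ext_eval fun z hz => (hS f z hz).trans (hf z hz).symm⟩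
  · rintro ⟨f, rfl⟩
    exact hSM f

end InnerMultiplier

/-! ### Operators commuting with the shift -/

namespace Hardy

open Filter

variable {E : Type u} [NormedAddCommGroup E] [InnerProductSpace ℂ E]

theorem Mlin_apply_zero (A B : E →L[ℂ] E) (f : Hardy E) : Mlin A B f 0 = A (f 0) := by
  simp [Mlin]

theorem Mlin_apply_succ (A B : E →L[ℂ] E) (f : Hardy E) (n : ℕ) :
    Mlin A B f (n + 1) = A (f (n + 1)) + B (f n) := by
  simp [Mlin]

theorem Mz_single (k : ℕ) (x : E) :
    Mz E (lp.single 2 k x) = (lp.single 2 (k + 1) x : Hardy E) := by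
  ext n
  cases n <;> simp [Pi.single_apply]

theorem Mlin_Mz (A B : E →L[ℂ] E) (f : Hardy E) : Mlin A B (Mz E f) = Mz E (Mlin A B f) := by
  ext n
  rcases n with _ | _ | n
  · simp [Mlin_apply_zero]
  · simp [Mlin_apply_succ, Mlin_apply_zero]
  · simp [Mlin_apply_succ]

theorem Mlin_single (A B : E →L[ℂ] E) (x : E) :
    Mlin A B (lp.single 2 0 x : Hardy E) = lp.single 2 0 (A x) + lp.single 2 1 (B x) := by
  ext n
  rcases n with _ | _ | n
  · simp [Mlin_apply_zero]
  · simp [Mlin_apply_succ]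
  · simp [Mlin_apply_succ]

theorem Mlin_injective {A B C D : E →L[ℂ] E} (h : Mlin A B = Mlin C D) : A = C ∧ B = D := by
  have hx : ∀ x : E, Mlin A B (lp.single 2 0 x : Hardy E) = Mlin C D (lp.single 2 0 x : Hardy E) :=
    fun x => by rw [h]
  refine ⟨ContinuousLinearMap.ext fun x => ?_, ContinuousLinearMap.ext fun x => ?_⟩
  · simpa [Mlin_apply_zero] using congrArg (fun f : Hardy E => f 0) (hx x)
  · simpa [Mlin_apply_succ] using congrArg (fun f : Hardy E => f 1) (hx x)

theorem inner_eq_tsum (f g : Hardy E) : inner ℂ f g = ∑' n, inner ℂ (f n) (g n) :=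
  lp.inner_eq_tsum f g

theorem inner_Mz_Mz (f g : Hardy E) : inner ℂ (Mz E f) (Mz E g) = inner ℂ f g := by
  have hs := lp.summable_inner (𝕜 := ℂ) (Mz E f) (Mz E g)
  rw [inner_eq_tsum, hs.tsum_eq_zero_add, inner_eq_tsum]
  simp

/-- A bounded operator commuting with the shift is determined by its values on constants. -/
theorem ext_of_commute_Mz {S T : Hardy E →L[ℂ] Hardy E}
    (hS : ∀ f, S (Mz E f) = Mz E (S f)) (hT : ∀ f, T (Mz E f) = Mz E (T f))
    (h : ∀ x : E, S (lp.single 2 0 x) = T (lp.single 2 0 x)) : S = T := by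
  have hk : ∀ (k : ℕ) (x : E), S (lp.single 2 k x) = T (lp.single 2 k x) := by
    intro k x
    induction k with
    | zero => exact h x
    | succ k ih => rw [← Mz_single, hS, hT, ih]
  ext1 f
  refine tendsto_nhds_unique ((S.continuous.tendsto f).comp (tendsto_poly f))
    (((T.continuous.tendsto f).comp (tendsto_poly f)).congr fun N => ?_)
  simp only [Function.comp_apply, poly, map_sum, hk]

/-- The `n`-th Taylor coefficient of `S x`, as an operator in the vector `x`. -/
noncomputable def symbolCoeff (S : Hardy E →L[ℂ] Hardy E) (n : ℕ) : E →L[ℂ] E :=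
  lp.evalCLM ℂ (fun _ : ℕ => E) 2 n ∘L S ∘L lp.singleContinuousLinearMap ℂ (fun _ : ℕ => E) 2 0

theorem symbolCoeff_apply (S : Hardy E →L[ℂ] Hardy E) (n : ℕ) (x : E) :
    symbolCoeff S n x = S (lp.single 2 0 x) n := rfl

variable [CompleteSpace E]

/-- `M_{F₁* + F₂ z} = (M_{F₂* + F₁ z})* M_z`, in weak form. -/
theorem inner_Mlin_left (F₁ F₂ : E →L[ℂ] E) (f g : Hardy E) :
    inner ℂ (Mlin (F₁†) F₂ f) g = inner ℂ (Mz E f) (Mlin (F₂†) F₁ g) := by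
  have h₁ : inner ℂ (Mconst (F₁†) f) g = inner ℂ f (Mconst F₁ g) := by
    simp_rw [inner_eq_tsum, Mconst_apply, ContinuousLinearMap.adjoint_inner_left]
  have h₂ : inner ℂ (Mz E (Mconst F₂ f)) g = inner ℂ (Mz E f) (Mconst (F₂†) g) := by
    simp_rw [inner_eq_tsum]
    refine tsum_congr fun n => ?_
    cases n <;> simp [ContinuousLinearMap.adjoint_inner_right]
  simp only [Mlin, add_apply, ContinuousLinearMap.comp_apply, inner_add_left,
    inner_add_right]
  rw [h₁, h₂, inner_Mz_Mz, add_comm]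

/-- The adjoint relation turns the coefficients of `S₁ x` into first coefficients of `S₂ (zⁿ y) = zⁿ
S₂ y`, which vanish for `n ≥ 2`. -/
theorem eq_Mlin_of_inner {S₁ S₂ : Hardy E →L[ℂ] Hardy E}
    (h₁ : ∀ f, S₁ (Mz E f) = Mz E (S₁ f)) (h₂ : ∀ f, S₂ (Mz E f) = Mz E (S₂ f))
    (h : ∀ f g, inner ℂ (S₁ f) g = inner ℂ (Mz E f) (S₂ g)) :
    S₁ = Mlin (symbolCoeff S₁ 0) ((symbolCoeff S₂ 0)†) := by
  refine ext_of_commute_Mz h₁ (Mlin_Mz _ _) fun x => ?_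
  have hcoeff : ∀ (n : ℕ) (y : E),
      inner ℂ (S₁ (lp.single 2 0 x) n) y = inner ℂ x (S₂ (lp.single 2 n y) 1) := fun n y => by
    have := h (lp.single 2 0 x) (lp.single 2 n y)
    rwa [lp.inner_single_right, Mz_single, lp.inner_single_left] at this
  rw [Mlin_single]
  ext n
  rcases n with _ | _ | n
  · simp [symbolCoeff_apply]
  -- The first coefficient of `z S₂ y` is the constant coefficient of `S₂ y`, whence the adjoint.
  · refine ext_inner_right ℂ fun y => ?_
    rw [hcoeff, ← Mz_single, h₂]
    simp [ContinuousLinearMap.adjoint_inner_left, symbolCoeff_apply]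
  · refine ext_inner_right ℂ fun y => ?_
    rw [hcoeff, ← Mz_single, ← Mz_single, h₂, h₂]
    simp

end Hardy

/-! ### Joint invariant subspaces -/

section Compression

open Hardy

variable {E Estar : Type u}
  [NormedAddCommGroup E] [InnerProductSpace ℂ E] [CompleteSpace E]
  [NormedAddCommGroup Estar] [InnerProductSpace ℂ Estar] [CompleteSpace Estar]

/-- An operator leaving the range of an isometry `T` invariant is pulled back along `T`. -/
theorem LinearIsometry.exists_intertwining {H K : Type*}
    [NormedAddCommGroup H] [InnerProductSpace ℂ H] [CompleteSpace H]
    [NormedAddCommGroup K] [InnerProductSpace ℂ K] [CompleteSpace K]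
    (T : H →ₗᵢ[ℂ] K) (A : K →L[ℂ] K) (h : ∀ f, ∃ g, T g = A (T f)) :
    ∃ S : H →L[ℂ] H, ∀ f, T (S f) = A (T f) := by
  -- `T*` inverts `T` on its range, so `T* A T` is the pullback.
  refine ⟨(T.toContinuousLinearMap†) ∘L A ∘L T.toContinuousLinearMap, fun f => ?_⟩
  obtain ⟨g, hg⟩ := h f
  have : (T.toContinuousLinearMap†) (T g) = g := ext_inner_right ℂ fun k => by
    rw [ContinuousLinearMap.adjoint_inner_left]
    exact T.inner_map_map g k
  simp only [ContinuousLinearMap.comp_apply, LinearIsometry.coe_toContinuousLinearMap]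
  rw [← hg, this]

variable {Θ : ℂ → Estar →L[ℂ] E} {T : Hardy Estar →ₗᵢ[ℂ] Hardy E}

theorem map_Mz_of_eval (hT : ∀ f, ∀ z ∈ Metric.ball (0 : ℂ) 1, eval (T f) z = Θ z (eval f z))
    (f : Hardy Estar) : T (Mz Estar f) = Mz E (T f) :=
  ext_eval fun z hz => by rw [hT _ z hz, eval_Mz _ hz, eval_Mz _ hz, hT _ z hz, map_smul]

/-- Intertwining of multiplication operators by `T` is intertwining of the symbols by `Θ`. -/
theorem map_Mlin_iff_of_eval
    (hT : ∀ f, ∀ z ∈ Metric.ball (0 : ℂ) 1, eval (T f) z = Θ z (eval f z))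
    (A B : E →L[ℂ] E) (C D : Estar →L[ℂ] Estar) :
    (∀ f, T (Mlin C D f) = Mlin A B (T f)) ↔
      ∀ z ∈ Metric.ball (0 : ℂ) 1, (A + z • B) ∘L Θ z = Θ z ∘L (C + z • D) := by
  refine ⟨fun h z hz => ?_, fun h f => ext_eval fun z hz => ?_⟩
  · ext x
    have := congrArg (fun g => eval g z) (h (lp.single 2 0 x))
    simp only [hT _ z hz, eval_Mlin _ _ _ hz, eval_single, pow_zero, one_smul] at this
    exact this.symm
  · rw [hT _ z hz, eval_Mlin _ _ _ hz, eval_Mlin _ _ _ hz, hT _ z hz]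
    exact (DFunLike.congr_fun (h z hz) (eval f z)).symm

/-- If the range of `T` is jointly invariant, then the compressions of the two multiplication
operators are again of the form `M_{G₁ + G₂* z}`, `M_{G₂ + G₁* z}`. -/
theorem exists_symbols_of_invariant
    (hT : ∀ f, ∀ z ∈ Metric.ball (0 : ℂ) 1, eval (T f) z = Θ z (eval f z))
    (F₁ F₂ : E →L[ℂ] E)
    (h₁ : ∀ f, ∃ g, T g = Mlin (F₁†) F₂ (T f)) (h₂ : ∀ f, ∃ g, T g = Mlin (F₂†) F₁ (T f)) :
    ∃ G₁ G₂ : Estar →L[ℂ] Estar,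
      (∀ f, T (Mlin G₁ (G₂†) f) = Mlin (F₁†) F₂ (T f)) ∧
      ∀ f, T (Mlin G₂ (G₁†) f) = Mlin (F₂†) F₁ (T f) := by
  obtain ⟨S₁, hS₁⟩ := T.exists_intertwining _ h₁
  obtain ⟨S₂, hS₂⟩ := T.exists_intertwining _ h₂
  have hMz := map_Mz_of_eval hT
  have c₁ : ∀ f, S₁ (Mz Estar f) = Mz Estar (S₁ f) := fun f => T.injective <| by
    rw [hS₁, hMz, hMz, hS₁, Mlin_Mz]
  have c₂ : ∀ f, S₂ (Mz Estar f) = Mz Estar (S₂ f) := fun f => T.injective <| by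
    rw [hS₂, hMz, hMz, hS₂, Mlin_Mz]
  have i₁ : ∀ f g, inner ℂ (S₁ f) g = inner ℂ (Mz Estar f) (S₂ g) := fun f g => by
    rw [← T.inner_map_map, ← T.inner_map_map (Mz Estar f), hS₁, hS₂, hMz, inner_Mlin_left]
  have i₂ : ∀ f g, inner ℂ (S₂ f) g = inner ℂ (Mz Estar f) (S₁ g) := fun f g => by
    rw [← T.inner_map_map, ← T.inner_map_map (Mz Estar f), hS₁, hS₂, hMz, inner_Mlin_left]
  refine ⟨symbolCoeff S₁ 0, symbolCoeff S₂ 0, fun f => ?_, fun f => ?_⟩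
  · rw [← eq_Mlin_of_inner c₁ c₂ i₁, hS₁]
  · rw [← eq_Mlin_of_inner c₂ c₁ i₂, hS₂]

end Compression

/-! ### The main theorem. -/

theorem theorem3p1 {E Estar : Type u}
    [NormedAddCommGroup E] [InnerProductSpace ℂ E] [CompleteSpace E]
    [NormedAddCommGroup Estar] [InnerProductSpace ℂ Estar] [CompleteSpace Estar]
    (F₁ F₂ : E →L[ℂ] E)
    (M : Submodule ℂ (Hardy E)) (hM_closed : IsClosed (M : Set (Hardy E))) (hM_ne : M ≠ ⊥)
    (Θ : ℂ → Estar →L[ℂ] E) (hΘ : IsBLHRepresentation M Θ) :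
    ((∀ f ∈ M, Hardy.Mlin (F₁†) F₂ f ∈ M ∧ Hardy.Mlin (F₂†) F₁ f ∈ M ∧
          Hardy.Mz E f ∈ M) ↔
      ∃! G : (Estar →L[ℂ] Estar) × (Estar →L[ℂ] Estar), ∀ z ∈ Metric.ball (0 : ℂ) 1,
        (F₁† + z • F₂) ∘L Θ z = Θ z ∘L (G.1 + z • (G.2)†) ∧
        (F₂† + z • F₁) ∘L Θ z = Θ z ∘L (G.2 + z • (G.1)†)) ∧
    (IsTetrablockIsometry (Hardy.Mlin (F₁†) F₂) (Hardy.Mlin (F₂†) F₁)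
        (Hardy.Mz E) →
      ∀ G₁ G₂ : Estar →L[ℂ] Estar,
        (∀ z ∈ Metric.ball (0 : ℂ) 1,
          (F₁† + z • F₂) ∘L Θ z = Θ z ∘L (G₁ + z • G₂†) ∧
          (F₂† + z • F₁) ∘L Θ z = Θ z ∘L (G₂ + z • G₁†)) →
        IsTetrablockIsometry (Hardy.Mlin G₁ (G₂†)) (Hardy.Mlin G₂ (G₁†))
          (Hardy.Mz Estar)) := by
  obtain ⟨T, hT, hTM⟩ := hΘ.exists_linearIsometry
  have hiff : ∀ G₁ G₂ : Estar →L[ℂ] Estar, (∀ z ∈ Metric.ball (0 : ℂ) 1,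
        (F₁† + z • F₂) ∘L Θ z = Θ z ∘L (G₁ + z • G₂†) ∧
        (F₂† + z • F₁) ∘L Θ z = Θ z ∘L (G₂ + z • G₁†)) ↔
      (∀ f, T (Hardy.Mlin G₁ (G₂†) f) = Hardy.Mlin (F₁†) F₂ (T f)) ∧
      ∀ f, T (Hardy.Mlin G₂ (G₁†) f) = Hardy.Mlin (F₂†) F₁ (T f) := fun G₁ G₂ => by
    rw [map_Mlin_iff_of_eval hT, map_Mlin_iff_of_eval hT]
    exact forall₂_and
  refine ⟨⟨fun h => ?_, ?_⟩, ?_⟩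
  · obtain ⟨G₁, G₂, h₁, h₂⟩ := exists_symbols_of_invariant hT F₁ F₂
      (fun f => (hTM _).mp (h _ ((hTM _).mpr ⟨f, rfl⟩)).1)
      (fun f => (hTM _).mp (h _ ((hTM _).mpr ⟨f, rfl⟩)).2.1)
    refine ⟨(G₁, G₂), (hiff G₁ G₂).mpr ⟨h₁, h₂⟩, ?_⟩
    rintro ⟨G₁', G₂'⟩ hG'
    obtain ⟨h₁', h₂'⟩ := (hiff G₁' G₂').mp hG'
    have e₁ : Hardy.Mlin G₁' (G₂'†) = Hardy.Mlin G₁ (G₂†) :=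
      ContinuousLinearMap.ext fun f => T.injective ((h₁' f).trans (h₁ f).symm)
    have e₂ : Hardy.Mlin G₂' (G₁'†) = Hardy.Mlin G₂ (G₁†) :=
      ContinuousLinearMap.ext fun f => T.injective ((h₂' f).trans (h₂ f).symm)
    -- The constant coefficients alone give `G₁' = G₁` and `G₂' = G₂`.
    rw [(Hardy.Mlin_injective e₁).1, (Hardy.Mlin_injective e₂).1]
  · rintro ⟨⟨G₁, G₂⟩, hG, -⟩ f hf
    obtain ⟨h₁, h₂⟩ := (hiff G₁ G₂).mp hG
    obtain ⟨g, rfl⟩ := (hTM f).mp hf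
    exact ⟨(hTM _).mpr ⟨_, h₁ g⟩, (hTM _).mpr ⟨_, h₂ g⟩, (hTM _).mpr ⟨_, map_Mz_of_eval hT g⟩⟩
  · rintro ⟨K, i₁, i₂, i₃, A, B, P, V, hU, hV⟩ G₁ G₂ hG
    obtain ⟨h₁, h₂⟩ := (hiff G₁ G₂).mp hG
    refine ⟨K, i₁, i₂, i₃, A, B, P, V.comp T, hU, fun f => ?_⟩
    have := hV (T f)
    rw [← h₁, ← h₂, ← map_Mz_of_eval hT] at this
    exact this
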